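/- A finite graph is a \emph{hyperbolic uniform disk graph} if, for some $r>0$ (which may depend on the graph), it is the intersection graph of closed disks of radius $r$ in the hyperbolic plane. The tree-independence number $\mathrm{tree}\text{-}\alpha(G)$ of a finite graph $G$ is the minimum, over all tree decompositions of $G$, of the maximum independence number of a subgraph induced by a bag. The local tree-independence number of $G$ is the function that maps $r\in\mathbb{N}$ to the maximum over $v\in V(G)$ of $\mathrm{tree}\text{-}\alpha(G[N^r[v]])$, where $N^r[v]$ is the set of vertices at distance at most $r$ from $v$; it is bounded on a graph class if there is a function $f\colon\mathbb{N}\to\mathbb{N}$ with $\mathrm{tree}\text{-}\alpha(G[N^r[v]])\le f(r)$ for all $G$ in the class, all $v\in V(G)$ and all $r\in\mathbb{N}$. The layered tree-independence number of $G$ is the least $k$ for which there are a tree decomposition of $G$ and a partition of $V(G)$ into layers $V_0,V_1,\dots$, with every edge of $G$ inside a layer or between two consecutive layers, such that the intersection of any bag with any layer induces a subgraph of independence number at most $k$. The local tree-independence number and the layered tree-independence number of hyperbolic uniform disk graphs are both unbounded. The former is unbounded already for closed neighbourhoods of vertices: for every $k$ there are a hyperbolic uniform disk graph $G$ and a vertex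 $v$ of $G$ with $\mathrm{tree}\text{-}\alpha(G[N[v]])>k$. -/

import Mathlib

/-- `G` is a hyperbolic uniform disk graph with disk radius `r`: every vertex `v` is represented by
the closed disk of radius `r` around a point `p v` of the hyperbolic plane (the upper half-plane
with its hyperbolic metric of curvature `-1`), and two distinct vertices are adjacent if and only
if their disks intersect. -/
def SimpleGraph.IsHUDGWithRadius {V : Type*} (G : SimpleGraph V) (r : ℝ) : Prop :=
  ∃ p : V → UpperHalfPlane, ∀ u v : V, u ≠ v →
    (G.Adj u v ↔ (Metric.closedBall (p u) r ∩ Metric.closedBall (p v) r).Nonempty)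

/-- `G` is a hyperbolic uniform disk graph: an intersection graph of disks of a common positive
radius in the hyperbolic plane. The radius may depend on the graph. -/
def SimpleGraph.IsHUDG {V : Type*} (G : SimpleGraph V) : Prop :=
  ∃ r : ℝ, 0 < r ∧ G.IsHUDGWithRadius r

/-- A tree decomposition of `G` whose tree has the node set `ι`. -/
structure SimpleGraph.TreeDecomposition {V : Type*} (G : SimpleGraph V) (ι : Type) where
  /-- The tree. -/
  tree : SimpleGraph ι
  /-- The bags. -/
  bag : ι → Set V
  isTree : tree.IsTree
  /-- Both endpoints of every edge lie in a common bag. -/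
  edge_cover : ∀ u v : V, G.Adj u v → ∃ t : ι, u ∈ bag t ∧ v ∈ bag t
  /-- Every vertex lies in some bag. -/
  vertex_cover : ∀ v : V, ∃ t : ι, v ∈ bag t
  /-- The nodes whose bags contain a given vertex induce a connected subgraph of the tree. -/
  connected_trace : ∀ v : V, (tree.induce {t : ι | v ∈ bag t}).Connected

/-- The tree-independence number of a finite graph: the least `k` such that some tree decomposition
(over a finite tree) has only bags that induce subgraphs of independence number at most `k`. -/
noncomputable def SimpleGraph.treeAlpha {V : Type*} (G : SimpleGraph V) : ℕ :=
  sInf {k : ℕ | ∃ (ι : Type) (_ : Finite ι) (D : G.TreeDecomposition ι),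
    ∀ t : ι, (G.induce (D.bag t)).indepNum ≤ k}

/-- The set of vertices at distance at most `r` from `v` in `G`. -/
def SimpleGraph.closedNeighborhood {V : Type*} (G : SimpleGraph V) (r : ℕ) (v : V) : Set V :=
  {u : V | G.edist v u ≤ (r : ℕ∞)}

/-- The local tree-independence number of a finite graph, as a function of the distance `r`: the
maximum of the tree-independence numbers of the subgraphs induced by the vertices at distance at
most `r` from a vertex `v`, over all `v`. -/
noncomputable def SimpleGraph.localTreeAlpha {V : Type*} (G : SimpleGraph V) (r : ℕ) : ℕ :=
  ⨆ v : V, (G.induce (G.closedNeighborhood r v)).treeAlpha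

/-- `L` describes a layering of `G` (with layers `{v | L v = i}`): every edge has its endpoints in
one layer or in two consecutive layers. -/
def SimpleGraph.IsLayering {V : Type*} (G : SimpleGraph V) (L : V → ℕ) : Prop :=
  ∀ u v : V, G.Adj u v → L u ≤ L v + 1 ∧ L v ≤ L u + 1

/-- The layered tree-independence number of a finite graph: the least `k` such that, for some tree
decomposition (over a finite tree) and some layering, the intersection of any bag with any layer
induces a subgraph of independence number at most `k`. -/
noncomputable def SimpleGraph.layeredTreeAlpha {V : Type*} (G : SimpleGraph V) : ℕ :=
  sInf {k : ℕ | ∃ (ι : Type) (_ : Finite ι) (D : G.TreeDecomposition ι) (L : V → ℕ),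
    G.IsLayering L ∧
      ∀ (t : ι) (i : ℕ), (G.induce (D.bag t ∩ {v : V | L v = i})).indepNum ≤ k}

/-- The finite graphs in the class `C` have bounded local tree-independence number: it is bounded by
a function of the distance alone. -/
def HasBoundedLocalTreeAlpha (C : ∀ V : Type, SimpleGraph V → Prop) : Prop :=
  ∃ f : ℕ → ℕ, ∀ (V : Type) [Finite V] (G : SimpleGraph V), C V G →
    ∀ r : ℕ, G.localTreeAlpha r ≤ f r

/-- The finite graphs in the class `C` have bounded layered tree-independence number. -/
def HasBoundedLayeredTreeAlpha (C : ∀ V : Type, SimpleGraph V → Prop) : Prop :=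
  ∃ k : ℕ, ∀ (V : Type) [Finite V] (G : SimpleGraph V), C V G → G.layeredTreeAlpha ≤ k

/-! ### Subtrees of a tree and brambles -/

namespace SimpleGraph

/-! In the upper half-plane, disks of radius `r` around `z` and `w` meet iff the squared Euclidean
distance of `z` and `w` is at most `(2 sinh r)^2 * z.im * w.im`. For large `r`, rows of points at
tiny heights thus realize `weightedRows`, where adjacency compares horizontal distance with a
product of weights, and a point at height 1 is adjacent to everything.

In `weightedRows`, consider the subsets of a single row `i` that meet every window of length `16 *
64 ^ i`. They are connected and pairwise touch, so by the Helly property of subtrees some bag meets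
them all. Hence the bag contains a whole window of each row: otherwise the vertices of the row
outside the bag would be such a subset. A greedy choice of one point per window, from light rows to
heavy ones, is independent, so some bag contains an independent set of size `m`.

The universal vertex makes its closed neighbourhood the whole graph, and it leaves only three
possible layers, one of which keeps at least a third of the independent set. -/

theorem Connected.exists_adj_forall_reachable_deleteEdges {ι : Type*} {T : SimpleGraph ι}
    (hT : T.Connected) {S : Set ι} (hS : (T.induce S).Connected) {t : ι} (ht : t ∉ S) :
    ∃ t', T.Adj t t' ∧ ∀ q ∈ S, (T.deleteEdges {s(t, t')}).Reachable t' q := by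
  obtain ⟨⟨q₀, hq₀⟩⟩ := hS.nonempty
  obtain ⟨p, hp⟩ := (hT t q₀).exists_isPath
  cases p with
  | nil => exact absurd hq₀ ht
  | @cons _ t' _ h p =>
    rw [Walk.cons_isPath_iff] at hp
    refine ⟨t', h, fun q hq => ?_⟩
    have h₁ : (T.deleteEdges {s(t, t')}).Reachable t' q₀ :=
      ⟨p.toDeleteEdge _ fun he => hp.2 (p.fst_mem_support_of_mem_edges he)⟩
    let φ : T.induce S →g T.deleteEdges {s(t, t')} :=
      { toFun := Subtype.val
        map_rel' := by
          rintro ⟨a, ha⟩ ⟨b, hb⟩ hab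
          rw [deleteEdges_adj]
          refine ⟨hab, fun he => ?_⟩
          rcases Sym2.eq_iff.1 (Set.mem_singleton_iff.1 he) with ⟨h, -⟩ | ⟨-, h⟩
          · exact ht (h ▸ ha)
          · exact ht (h ▸ hb) }
    exact h₁.trans ((hS ⟨q₀, hq₀⟩ ⟨q, hq⟩).map φ)

/-- The Helly property of subtrees of a finite tree. -/
theorem IsTree.exists_forall_mem_of_pairwise_inter {ι κ : Type*} [Finite ι] {T : SimpleGraph ι}
    (hT : T.IsTree) (S : κ → Set ι) (hS : ∀ k, (T.induce (S k)).Connected)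
    (hST : ∀ k l, (S k ∩ S l).Nonempty) : ∃ t, ∀ k, t ∈ S k := by
  classical
  by_contra! hne
  cases nonempty_fintype ι
  choose k hk using hne
  choose n hadj hn using fun t =>
    hT.connected.exists_adj_forall_reachable_deleteEdges (hS (k t)) (hk t)
  -- Each node picks the edge towards a subtree avoiding it. There are fewer edges than nodes, so
  -- two nodes pick the same edge from opposite ends; their subtrees lie on opposite sides of this
  -- bridge and cannot intersect.
  have hcard : T.edgeFinset.card < (Finset.univ : Finset ι).card := by
    have := hT.card_edgeFinset
    rw [Finset.card_univ]
    omega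
  obtain ⟨t, -, t', -, htt', he⟩ := Finset.exists_ne_map_eq_of_card_lt_of_maps_to hcard
    (f := fun t => s(t, n t)) (fun t _ => by simpa using hadj t)
  obtain ⟨h, -⟩ | ⟨h₁, h₂⟩ := Sym2.eq_iff.1 he
  · exact htt' h
  obtain ⟨q, hq, hq'⟩ := hST (k t) (k t')
  have r := hn t q hq
  have r' := hn t' q hq'
  rw [← h₁, Sym2.eq_swap] at r'
  rw [h₂] at r
  have hb := isAcyclic_iff_forall_adj_isBridge.1 hT.isAcyclic (hadj t)
  rw [h₂] at hb
  exact isBridge_iff.1 hb (r'.trans r.symm)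

namespace TreeDecomposition

variable {V : Type*} {G : SimpleGraph V} {ι : Type}

/-- The traces of adjacent vertices share a node, namely one whose bag covers the edge, so walks in
`Q` glue traces together. -/
theorem connected_induce_setOf_inter_bag (D : G.TreeDecomposition ι) {Q : Set V}
    (hQ : (G.induce Q).Connected) : (D.tree.induce {t | (Q ∩ D.bag t).Nonempty}).Connected := by
  have htrace (v : V) (hv : v ∈ Q) (s t) (hs : v ∈ D.bag s) (ht : v ∈ D.bag t) :
      (D.tree.induce {t | (Q ∩ D.bag t).Nonempty}).Reachable ⟨s, v, hv, hs⟩ ⟨t, v, hv, ht⟩ :=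
    (D.connected_trace v ⟨s, hs⟩ ⟨t, ht⟩).map
      (D.tree.induceHomOfLE (s' := {t | (Q ∩ D.bag t).Nonempty}) fun _ h => ⟨v, hv, h⟩).toHom
  have key (u v : Q) (p : (G.induce Q).Walk u v) : ∀ s t (hs : ↑u ∈ D.bag s) (ht : ↑v ∈ D.bag t),
      (D.tree.induce {t | (Q ∩ D.bag t).Nonempty}).Reachable
        ⟨s, u, u.2, hs⟩ ⟨t, v, v.2, ht⟩ := by
    induction p with
    | nil => exact fun s t hs ht => htrace _ (Subtype.prop _) s t hs ht
    | cons h p ih =>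
      intro s t hs ht
      obtain ⟨b, hb, hb'⟩ := D.edge_cover _ _ h
      exact (htrace _ (Subtype.prop _) s b hs hb).trans (ih b t hb' ht)
  obtain ⟨v⟩ := hQ.nonempty
  obtain ⟨t, ht⟩ := D.vertex_cover v
  have : Nonempty {t | (Q ∩ D.bag t).Nonempty} := ⟨⟨t, v, v.2, ht⟩⟩
  refine ⟨?_⟩
  rintro ⟨s, u, hu, hs⟩ ⟨t, w, hw, ht⟩
  obtain ⟨p⟩ := hQ ⟨u, hu⟩ ⟨w, hw⟩
  exact key _ _ p s t hs ht

/-- Some bag of a tree decomposition meets all members of a bramble. -/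
theorem exists_bag_inter_nonempty {κ : Type*} [Finite ι] (D : G.TreeDecomposition ι)
    (Q : κ → Set V) (hQ : ∀ k, (G.induce (Q k)).Connected)
    (htouch : ∀ k l, ∃ u ∈ Q k, ∃ v ∈ Q l, u = v ∨ G.Adj u v) :
    ∃ t, ∀ k, (Q k ∩ D.bag t).Nonempty := by
  refine D.isTree.exists_forall_mem_of_pairwise_inter _
    (fun k => D.connected_induce_setOf_inter_bag (hQ k)) fun k l => ?_
  obtain ⟨u, hu, v, hv, rfl | huv⟩ := htouch k l
  · obtain ⟨t, ht⟩ := D.vertex_cover u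
    exact ⟨t, ⟨u, hu, ht⟩, ⟨u, hv, ht⟩⟩
  · obtain ⟨t, ht, ht'⟩ := D.edge_cover u v huv
    exact ⟨t, ⟨u, hu, ht⟩, ⟨v, hv, ht'⟩⟩

/-- The restriction of a tree decomposition to an induced subgraph. -/
def comap {W : Type*} {H : SimpleGraph W} (D : G.TreeDecomposition ι) (φ : H ↪g G) :
    H.TreeDecomposition ι where
  tree := D.tree
  bag t := φ ⁻¹' D.bag t
  isTree := D.isTree
  edge_cover _ _ h := D.edge_cover _ _ (φ.map_adj_iff.2 h)
  vertex_cover v := D.vertex_cover (φ v)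
  connected_trace v := D.connected_trace (φ v)

/-- The tree decomposition with a single bag. -/
def trivial (G : SimpleGraph V) : G.TreeDecomposition Unit where
  tree := ⊥
  bag _ := Set.univ
  isTree := IsTree.of_subsingleton
  edge_cover _ _ _ := ⟨(), _root_.trivial, _root_.trivial⟩
  vertex_cover _ := ⟨(), _root_.trivial⟩
  connected_trace v := by
    have : Nonempty {_t : Unit | v ∈ (Set.univ : Set V)} := ⟨⟨(), _root_.trivial⟩⟩
    exact ⟨Preconnected.of_subsingleton⟩

end TreeDecomposition

theorem card_le_indepNum_induce {V : Type*} [Finite V] {G : SimpleGraph V} {B : Set V}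
    {s : Finset V} (hsB : ↑s ⊆ B) (hs : G.IsIndepSet s) : s.card ≤ (G.induce B).indepNum := by
  classical
  have h : (G.induce B).IsIndepSet (s.subtype (· ∈ B) : Finset B) := by
    intro a ha b hb hab
    exact hs (by simpa using ha) (by simpa using hb) (Subtype.coe_injective.ne hab)
  have h' := h.card_le_indepNum
  rwa [Finset.card_subtype, Finset.filter_true_of_mem fun x hx => hsB hx] at h'

theorem le_treeAlpha {V : Type*} {G : SimpleGraph V} {n : ℕ}
    (h : ∀ (ι : Type) [Finite ι] (D : G.TreeDecomposition ι),
      ∃ t, n ≤ (G.induce (D.bag t)).indepNum) : n ≤ G.treeAlpha := by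
  -- The one-bag decomposition rules out the junk value `sInf ∅ = 0`.
  refine le_csInf ⟨(G.induce Set.univ).indepNum, Unit, inferInstance,
    TreeDecomposition.trivial G, fun _ => le_rfl⟩ ?_
  rintro k ⟨ι, _, D, hD⟩
  obtain ⟨t, ht⟩ := h ι D
  exact ht.trans (hD t)

theorem exists_layering_of_layeredTreeAlpha_le {V : Type*} [Finite V] {G : SimpleGraph V} {k : ℕ}
    (h : G.layeredTreeAlpha ≤ k) :
    ∃ (ι : Type) (_ : Finite ι) (D : G.TreeDecomposition ι) (L : V → ℕ), G.IsLayering L ∧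
      ∀ (t : ι) (i : ℕ), (G.induce (D.bag t ∩ {v : V | L v = i})).indepNum ≤ k := by
  have hne : {k : ℕ | ∃ (ι : Type) (_ : Finite ι) (D : G.TreeDecomposition ι) (L : V → ℕ),
      G.IsLayering L ∧
        ∀ (t : ι) (i : ℕ), (G.induce (D.bag t ∩ {v : V | L v = i})).indepNum ≤ k}.Nonempty := by
    refine ⟨Nat.card V, Unit, inferInstance, TreeDecomposition.trivial G, fun _ => 0,
      fun _ _ _ => by simp, fun t i => ?_⟩
    obtain ⟨s, hs⟩ := exists_isNIndepSet_indepNum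
      (G := G.induce ((TreeDecomposition.trivial G).bag t ∩ {_v : V | 0 = i}))
    rw [← hs.card_eq, ← Nat.card_eq_finsetCard]
    exact Nat.card_le_card_of_injective (fun x : s => (x : V))
      (Subtype.val_injective.comp Subtype.val_injective)
  obtain ⟨ι, hι, D, L, hL, hk⟩ := Nat.sInf_mem hne
  exact ⟨ι, hι, D, L, hL, fun t i => (hk t i).trans h⟩

end SimpleGraph

/-! ### Realization by hyperbolic disks -/

open scoped UpperHalfPlane
namespace SimpleGraph
/-- The graph on `m` rows of `N` points each, where row `i` has the weight `8 ^ (i + 1)` and two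
points are adjacent if three times their horizontal distance is less than the product of their
weights. -/
def weightedRows (m N : ℕ) : SimpleGraph (Fin m × Fin N) where
  Adj a b := a ≠ b ∧ 3 * |(a.2 : ℤ) - b.2| < 8 ^ ((a.1 : ℕ) + b.1 + 2)
  symm := ⟨fun a b h => ⟨h.1.symm, by rw [abs_sub_comm, add_comm (b.1 : ℕ)]; exact h.2⟩⟩
  loopless := ⟨fun a h => h.1 rfl⟩
end SimpleGraph

/-- A hyperbolic ball around `z` is a Euclidean one with centre height `z.im * cosh r` and radius
`z.im * sinh r`. Two such balls meet iff the distance of the centres is at most the sum of the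
radii; squaring and `cosh² = sinh² + 1` give the formula. -/
theorem UpperHalfPlane.closedBall_inter_closedBall_nonempty_iff (z w : ℍ) {r : ℝ} (hr : 0 < r) :
    (Metric.closedBall z r ∩ Metric.closedBall w r).Nonempty ↔
      (z.re - w.re) ^ 2 + (z.im - w.im) ^ 2 ≤ (2 * Real.sinh r) ^ 2 * (z.im * w.im) := by
  have hs : 0 < Real.sinh r := Real.sinh_pos_iff.2 hr
  have hz := z.im_pos
  have hw := w.im_pos
  have h₁ : (Metric.closedBall z r ∩ Metric.closedBall w r).Nonempty ↔
      dist (z.center r : ℂ) (w.center r) ≤ z.im * Real.sinh r + w.im * Real.sinh r := by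
    rw [← Set.image_nonempty (f := ((↑) : ℍ → ℂ)),
      Set.image_inter UpperHalfPlane.coe_injective, image_coe_closedBall, image_coe_closedBall]
    constructor
    · rintro ⟨x, hx, hx'⟩
      exact (dist_triangle_right _ _ x).trans
        (add_le_add (by rwa [dist_comm]) (by rwa [dist_comm]))
    · intro h
      obtain ⟨y, hy, hy'⟩ := exists_dist_le_le (by positivity) (by positivity)
        (h.trans_eq (add_comm _ _))
      exact ⟨y, by rwa [Metric.mem_closedBall, dist_comm], hy'⟩
  rw [h₁, ← sq_le_sq₀ dist_nonneg (by positivity),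
    Complex.dist_eq_re_im, Real.sq_sqrt (by positivity)]
  simp only [coe_re, coe_im, center_re, center_im]
  have := Real.cosh_sq r
  have h₂ : (z.im * Real.cosh r - w.im * Real.cosh r) ^ 2
      = (z.im - w.im) ^ 2 * (Real.sinh r ^ 2 + 1) := by rw [← this]; ring
  rw [h₂]
  constructor <;> intro h <;> nlinarith

/-- Adding a universal vertex to `weightedRows m N` yields a hyperbolic uniform disk graph. -/
theorem SimpleGraph.exists_isHUDG_extending_weightedRows (m N : ℕ) :
    ∃ G : SimpleGraph (Option (Fin m × Fin N)), G.IsHUDG ∧ (∀ a, G.Adj none (some a)) ∧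
      ∀ a b, G.Adj (some a) (some b) ↔ (weightedRows m N).Adj a b := by
  -- `T` will be `2 sinh r`. The terms `9 * N ^ 2` and `1` bound the horizontal and vertical
  -- contributions to the distance from the universal vertex; `64 ^ (m + 1)` keeps all heights at
  -- most 1.
  obtain ⟨T, hT⟩ : ∃ T : ℝ, T = 9 * (N : ℝ) ^ 2 + 1 + 64 ^ (m + 1) := ⟨_, rfl⟩
  have hpow : (0 : ℝ) < 64 ^ (m + 1) := by positivity
  have hT0 : 0 < T := by rw [hT]; positivity
  let p : Option (Fin m × Fin N) → ℍ := fun o => o.elim ⟨⟨0, 1⟩, one_pos⟩ fun a =>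
    ⟨⟨3 * (a.2 : ℝ), 64 ^ ((a.1 : ℕ) + 1) / T⟩, by positivity⟩
  let r := Real.arsinh (T / 2)
  have hr : 0 < r := Real.arsinh_pos_iff.2 (by positivity)
  have hrT : 2 * Real.sinh r = T := by rw [Real.sinh_arsinh]; ring
  have hle (i : Fin m) : (64 : ℝ) ^ ((i : ℕ) + 1) ≤ 64 ^ (m + 1) :=
    pow_le_pow_right₀ (by norm_num) (by omega)
  have hle' (i : Fin m) : (64 : ℝ) ^ ((i : ℕ) + 1) ≤ T := 
    (hle i).trans (by rw [hT]; linarith [sq_nonneg (N : ℝ)])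
  let G : SimpleGraph (Option (Fin m × Fin N)) :=
    { Adj := fun u v => u ≠ v ∧ (Metric.closedBall (p u) r ∩ Metric.closedBall (p v) r).Nonempty
      symm := ⟨fun u v h => ⟨h.1.symm, by rw [Set.inter_comm]; exact h.2⟩⟩
      loopless := ⟨fun u h => h.1 rfl⟩ }
  refine ⟨G, ⟨r, hr, p, fun u v huv => by simp [G, huv]⟩, fun a => ⟨by simp, ?_⟩, fun a b => ?_⟩
  · rw [UpperHalfPlane.closedBall_inter_closedBall_nonempty_iff _ _ hr, hrT]
    change (0 - 3 * (a.2 : ℝ)) ^ 2 + (1 - 64 ^ ((a.1 : ℕ) + 1) / T) ^ 2 ≤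
      T ^ 2 * (1 * (64 ^ ((a.1 : ℕ) + 1) / T))
    have e : T ^ 2 * (1 * (64 ^ ((a.1 : ℕ) + 1) / T)) = T * 64 ^ ((a.1 : ℕ) + 1) := by field_simp
    rw [e]
    have h₁ : (64 : ℝ) ^ ((a.1 : ℕ) + 1) / T ≤ 1 := (div_le_one hT0).2 (hle' _)
    have h₂ : (0 : ℝ) ≤ 64 ^ ((a.1 : ℕ) + 1) / T := by positivity
    have h₃ : (1 : ℝ) ≤ 64 ^ ((a.1 : ℕ) + 1) := one_le_pow₀ (by norm_num)
    have h₄ : (a.2 : ℝ) ≤ N := by exact_mod_cast a.2.2.le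
    have h₅ : (a.2 : ℝ) ^ 2 ≤ (N : ℝ) ^ 2 := by gcongr
    have h₆ : T ≤ T * 64 ^ ((a.1 : ℕ) + 1) := le_mul_of_one_le_right hT0.le h₃
    nlinarith
  · change (some a ≠ some b ∧ _) ↔ (a ≠ b ∧ _)
    rw [UpperHalfPlane.closedBall_inter_closedBall_nonempty_iff _ _ hr, hrT, ne_eq, ne_eq,
      Option.some_inj]
    refine and_congr_right fun _ => ?_
    change (3 * (a.2 : ℝ) - 3 * (b.2 : ℝ)) ^ 2 +
      (64 ^ ((a.1 : ℕ) + 1) / T - 64 ^ ((b.1 : ℕ) + 1) / T) ^ 2 ≤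
      T ^ 2 * (64 ^ ((a.1 : ℕ) + 1) / T * (64 ^ ((b.1 : ℕ) + 1) / T)) ↔ _
    have e : T ^ 2 * (64 ^ ((a.1 : ℕ) + 1) / T * (64 ^ ((b.1 : ℕ) + 1) / T)) =
        (8 ^ ((a.1 : ℕ) + b.1 + 2)) ^ 2 := by
      field_simp
      rw [show (64 : ℝ) = 8 ^ 2 by norm_num, ← pow_mul, ← pow_mul, ← pow_mul, ← pow_add]
      ring_nf
    rw [e]
    have hd : |(64 : ℝ) ^ ((a.1 : ℕ) + 1) / T - 64 ^ ((b.1 : ℕ) + 1) / T| ≤ 1 := by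
      have ha : (64 : ℝ) ^ ((a.1 : ℕ) + 1) / T ≤ 1 := (div_le_one hT0).2 (hle' _)
      have hb : (64 : ℝ) ^ ((b.1 : ℕ) + 1) / T ≤ 1 := (div_le_one hT0).2 (hle' _)
      have ha' : (0 : ℝ) ≤ 64 ^ ((a.1 : ℕ) + 1) / T := by positivity
      have hb' : (0 : ℝ) ≤ 64 ^ ((b.1 : ℕ) + 1) / T := by positivity
      rw [abs_le]
      constructor <;> linarith
    have hd2 := (sq_le_one_iff_abs_le_one _).2 hd
    generalize (64 : ℝ) ^ ((a.1 : ℕ) + 1) / T - 64 ^ ((b.1 : ℕ) + 1) / T = ε at hd2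
    generalize (a.1 : ℕ) + b.1 + 2 = n
    have hM : (0 : ℤ) ≤ 8 ^ n := by positivity
    have hcast : (3 * (a.2 : ℝ) - 3 * (b.2 : ℝ)) ^ 2 =
        (((3 * |(a.2 : ℤ) - b.2|) ^ 2 : ℤ) : ℝ) := by
      rw [mul_pow, sq_abs]; push_cast; ring
    have hcast' : ((8 : ℝ) ^ n) ^ 2 = (((8 ^ n) ^ 2 : ℤ) : ℝ) := by push_cast; rfl
    rw [hcast, hcast']
    have hD : (0 : ℤ) ≤ |(a.2 : ℤ) - b.2| := abs_nonneg _
    generalize |(a.2 : ℤ) - b.2| = d at *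
    -- The vertical term `ε ^ 2 ≤ 1` never matters: `3 * d` and `8 ^ n` are integers, distinct
    -- because 3 does not divide `8 ^ n`, and if `3 * d` is smaller then the squares differ by at
    -- least 1.
    constructor
    · intro h
      have h' : (((3 * d) ^ 2 : ℤ) : ℝ) ≤ (((8 ^ n) ^ 2 : ℤ) : ℝ) := by linarith [sq_nonneg ε]
      have h'' : 3 * d ≤ 8 ^ n := (sq_le_sq₀ (by positivity) hM).1 (by exact_mod_cast h')
      refine lt_of_le_of_ne h'' fun heq => ?_
      have h3 : (3 : ℤ) ∣ 8 ^ n := ⟨d, heq.symm⟩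
      have := Int.prime_three.dvd_of_dvd_pow h3
      omega
    · intro h
      have h' : (3 * d) ^ 2 + 1 ≤ (8 ^ n) ^ 2 := by
        have := (sq_lt_sq₀ (by positivity) hM).2 h
        omega
      have h'' : (((3 * d) ^ 2 : ℤ) : ℝ) + 1 ≤ (((8 ^ n) ^ 2 : ℤ) : ℝ) := by exact_mod_cast h'
      linarith

/-! ### Greedy choice of separated points -/

namespace SimpleGraph

/-- Points can be chosen from windows of length `16 * 64 ^ i`, one for each `i < m`, such that the
points for `i` and `j` have distance at least `8 ^ (i + j + 2) / 3`. -/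
theorem exists_separated_mem_windows (a : ℕ → ℕ) (m : ℕ) :
    ∃ f : ℕ → ℕ, ∀ i < m, (a i ≤ f i ∧ f i < a i + 16 * 64 ^ i) ∧
      ∀ j < i, (8 : ℤ) ^ (i + j + 2) ≤ 3 * |(f i : ℤ) - f j| := by
  induction m with
  | zero => exact ⟨fun _ => 0, by simp⟩
  | succ n ih =>
    obtain ⟨f, hf⟩ := ih
    -- The half-width is `8 ^ (n + j + 2) / 2`, more than the required third, and an integer.
    let bad : ℕ → Finset ℤ := fun j =>
      Finset.Ioo (f j - 8 ^ (n + j + 1) * 4) (f j + 8 ^ (n + j + 1) * 4)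
    have hbad (j : ℕ) : (bad j).card ≤ 8 ^ (n + j + 2) := by
      simp only [bad, Int.card_Ioo]
      have : (8 : ℤ) ^ (n + j + 2) = 8 ^ (n + j + 1) * 8 := pow_succ _ _
      have hpos : (0 : ℤ) < 8 ^ (n + j + 1) := by positivity
      zify
      omega
    -- The geometric sum is below `(64 / 7) * 64 ^ n`, so the earlier rows cannot block a whole
    -- window.
    have hgeom : 7 * ∑ j ∈ Finset.range n, 8 ^ (n + j + 2) < 7 * (16 * 64 ^ n) := by
      have h (j : ℕ) : 8 ^ (n + j + 2) = 64 * 8 ^ n * 8 ^ j := by ring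
      simp only [h, ← Finset.mul_sum]
      have h7 : 7 * ∑ j ∈ Finset.range n, 8 ^ j < 8 ^ n := by
        clear * -
        induction n with
        | zero => simp
        | succ n ih =>
          rw [Finset.sum_range_succ, pow_succ]
          omega
      have h64 : 64 ^ n = 8 ^ n * 8 ^ n := by rw [← mul_pow]; norm_num
      have hpos : 0 < 8 ^ n := by positivity
      rw [h64]
      nlinarith
    have hcard : ((Finset.range n).biUnion bad).card <
        (Finset.Ico (a n : ℤ) (a n + 16 * 64 ^ n)).card := by
      calc _ ≤ ∑ j ∈ Finset.range n, (bad j).card := Finset.card_biUnion_le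
        _ ≤ ∑ j ∈ Finset.range n, 8 ^ (n + j + 2) := Finset.sum_le_sum fun j _ => hbad j
        _ < 16 * 64 ^ n := by omega
        _ = _ := by rw [Int.card_Ico]; zify; simp
    obtain ⟨x, hx, hxb⟩ := Finset.exists_mem_notMem_of_card_lt_card hcard
    rw [Finset.mem_Ico] at hx
    lift x to ℕ using by omega
    refine ⟨Function.update f n x, fun i hi => ?_⟩
    obtain hi | rfl := Nat.lt_succ_iff_lt_or_eq.1 hi
    · refine ⟨by simpa [hi.ne] using (hf i hi).1, fun j hj => ?_⟩
      simpa [hi.ne, (hj.trans hi).ne] using (hf i hi).2 j hj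
    · refine ⟨by simp only [Function.update_self]; exact_mod_cast hx, fun j hj => ?_⟩
      simp only [Function.update_self, Function.update_of_ne hj.ne]
      have hxj : (x : ℤ) ∉ bad j := fun h =>
        hxb (Finset.mem_biUnion.2 ⟨j, Finset.mem_range.2 hj, h⟩)
      simp only [bad, Finset.mem_Ioo, not_and_or, not_lt] at hxj
      have : (8 : ℤ) ^ (i + j + 2) = 8 ^ (i + j + 1) * 8 := pow_succ _ _
      have hpos : (0 : ℤ) < 8 ^ (i + j + 1) := by positivity
      rcases abs_cases ((x : ℤ) - f j) with h | h <;> omega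

/-! ### The bramble of sets meeting all windows -/

variable {m N : ℕ}

/-- The factor 16 lies between `64 / 7`, needed for the greedy choice, and `64 / 3`, needed here: `3
* 16 < 64 = 8 ^ 2`. -/
theorem weightedRows_adj_of_le {i j : Fin m} {x y : Fin N} (hij : i ≤ j)
    (hne : (i, x) ≠ (j, y)) (h : |(x : ℤ) - y| ≤ 16 * 64 ^ (i : ℕ)) :
    (weightedRows m N).Adj (i, x) (j, y) := by
  refine ⟨hne, ?_⟩
  have h₁ : (8 : ℤ) ^ ((i : ℕ) + i + 2) ≤ 8 ^ ((i : ℕ) + j + 2) :=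
    pow_le_pow_right₀ (by norm_num) (by have : (i : ℕ) ≤ j := hij; omega)
  have h₂ : (8 : ℤ) ^ ((i : ℕ) + i + 2) = 64 * 64 ^ (i : ℕ) := by
    rw [show (64 : ℤ) = 8 ^ 2 by norm_num, ← pow_mul]; ring
  have h₃ : (0 : ℤ) < 64 ^ (i : ℕ) := by positivity
  change 3 * |(x : ℤ) - y| < 8 ^ ((i : ℕ) + j + 2)
  omega

/-- The point set `s` meets every window of length `16 * 64 ^ i`. -/
def MeetsWindows (i : Fin m) (s : Set (Fin N)) : Prop :=
  ∀ a : ℕ, a + 16 * 64 ^ (i : ℕ) ≤ N → ∃ x ∈ s, a ≤ x ∧ (x : ℕ) < a + 16 * 64 ^ (i : ℕ)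

theorem window_le (hN : 16 * 64 ^ m ≤ N) (i : Fin m) : 16 * 64 ^ (i : ℕ) ≤ N :=
  (Nat.mul_le_mul_left _ (Nat.pow_le_pow_right (by norm_num) i.2.le)).trans hN

/-- The window starting just after a point of `s` contains another point of `s`, which is close
enough to be adjacent; so one can step from left to right. -/
theorem MeetsWindows.connected_induce (hN : 16 * 64 ^ m ≤ N) {i : Fin m} {s : Set (Fin N)}
    (hs : MeetsWindows i s) : ((weightedRows m N).induce (Prod.mk i '' s)).Connected := by
  have key (d : ℕ) : ∀ (x y : Fin N) (hx : x ∈ s) (hy : y ∈ s), x ≤ y → (y : ℕ) ≤ x + d →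
      ((weightedRows m N).induce (Prod.mk i '' s)).Reachable ⟨(i, x), x, hx, rfl⟩
        ⟨(i, y), y, hy, rfl⟩ := by
    induction d with
    | zero =>
      intro x y hx hy hxy hd
      obtain rfl : x = y := le_antisymm hxy hd
      exact Reachable.refl _
    | succ d ih =>
      intro x y hx hy hxy hd
      have hadj (z : Fin N) (hz : z ∈ s) (hxz : x < z) (h : (z : ℕ) ≤ x + 16 * 64 ^ (i : ℕ)) :
          ((weightedRows m N).induce (Prod.mk i '' s)).Reachable ⟨(i, x), x, hx, rfl⟩
            ⟨(i, z), z, hz, rfl⟩ := by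
        have hxz' : (x : ℕ) < z := hxz
        refine Adj.reachable (weightedRows_adj_of_le le_rfl (by simp [hxz.ne]) ?_)
        rw [abs_le]
        zify at h hxz'
        constructor <;> linarith
      obtain rfl | hlt := hxy.eq_or_lt
      · exact Reachable.refl _
      by_cases h : (y : ℕ) ≤ x + 16 * 64 ^ (i : ℕ)
      · exact hadj y hy hlt h
      · obtain ⟨z, hz, hz₁, hz₂⟩ := hs (x + 1) (by omega)
        exact (hadj z hz (Fin.lt_def.2 (by omega)) (by omega)).trans
          (ih z y hz hy (Fin.le_def.2 (by omega)) (by omega))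
  obtain ⟨x₀, hx₀, -⟩ := hs 0 (by simpa using window_le hN i)
  have : Nonempty (Prod.mk i '' s) := ⟨⟨(i, x₀), x₀, hx₀, rfl⟩⟩
  refine ⟨?_⟩
  rintro ⟨_, x, hx, rfl⟩ ⟨_, y, hy, rfl⟩
  rcases le_total x y with h | h
  · exact key y x y hx hy h (by omega)
  · exact (key x y x hy hx h (by omega)).symm

theorem MeetsWindows.exists_eq_or_adj (hN : 16 * 64 ^ m ≤ N) {i j : Fin m} {s t : Set (Fin N)}
    (hs : MeetsWindows i s) (ht : MeetsWindows j t) (hij : i ≤ j) :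
    ∃ u ∈ Prod.mk i '' s, ∃ v ∈ Prod.mk j '' t, u = v ∨ (weightedRows m N).Adj u v := by
  obtain ⟨y, hy, -⟩ := ht 0 (by simpa using window_le hN j)
  have hw := window_le hN i
  -- The window of row `i` starts at `y`, or is the last one if that would overrun the row; either
  -- way it contains `y`.
  obtain ⟨x, hx, hx₁, hx₂⟩ := hs (min y (N - 16 * 64 ^ (i : ℕ))) (by omega)
  refine ⟨_, ⟨x, hx, rfl⟩, _, ⟨y, hy, rfl⟩, ?_⟩
  by_cases h : (i, x) = (j, y)
  · exact Or.inl h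
  · refine Or.inr (weightedRows_adj_of_le hij h ?_)
    have hyN := y.2
    have : (x : ℕ) ≤ y + 16 * 64 ^ (i : ℕ) ∧ (y : ℕ) ≤ x + 16 * 64 ^ (i : ℕ) := by omega
    zify at this
    rw [abs_le]
    constructor <;> linarith

/-- Every tree decomposition of `weightedRows m N` has a bag with an independent set that meets all
rows. -/
theorem exists_bag_indep_transversal (hN : 16 * 64 ^ m ≤ N) {ι : Type} [Finite ι]
    (D : (weightedRows m N).TreeDecomposition ι) : ∃ (t : ι) (f : Fin m → Fin N),
      (∀ i, (i, f i) ∈ D.bag t) ∧ ∀ i j, ¬ (weightedRows m N).Adj (i, f i) (j, f j) := by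
  obtain ⟨t, ht⟩ := D.exists_bag_inter_nonempty
    (κ := {p : Fin m × Set (Fin N) // MeetsWindows p.1 p.2}) (fun p => Prod.mk p.1.1 '' p.1.2)
    (fun p => p.2.connected_induce hN) fun p q => by
      rcases le_total p.1.1 q.1.1 with h | h
      · exact p.2.exists_eq_or_adj hN q.2 h
      · obtain ⟨u, hu, v, hv, huv⟩ := q.2.exists_eq_or_adj hN p.2 h
        exact ⟨v, hv, u, hu, huv.imp Eq.symm Adj.symm⟩
  -- If every window of row `i` had a vertex outside the bag, these vertices would form a bramble
  -- member that the bag misses.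
  have hwin (i : Fin m) : ∃ a : ℕ, a + 16 * 64 ^ (i : ℕ) ≤ N ∧
      ∀ x : Fin N, a ≤ x → (x : ℕ) < a + 16 * 64 ^ (i : ℕ) → (i, x) ∈ D.bag t := by
    by_contra! h
    obtain ⟨_, ⟨x, hx, rfl⟩, hxt⟩ := ht ⟨(i, {x | (i, x) ∉ D.bag t}), fun a ha => by
      obtain ⟨x, h₁, h₂, h₃⟩ := h a ha
      exact ⟨x, h₃, h₁, h₂⟩⟩
    exact hx hxt
  choose a haN ha using hwin
  obtain ⟨f, hf⟩ := exists_separated_mem_windows (fun i => if h : i < m then a ⟨i, h⟩ else 0) m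
  have hf₁ (i : Fin m) : a i ≤ f i ∧ f i < a i + 16 * 64 ^ (i : ℕ) := by
    simpa using (hf i i.2).1
  have hfar (i j : Fin m) (hij : i < j) :
      (8 : ℤ) ^ ((i : ℕ) + j + 2) ≤ 3 * |(f i : ℤ) - f j| := by
    rw [abs_sub_comm, add_comm (i : ℕ)]
    exact (hf j j.2).2 i hij
  refine ⟨t, fun i => ⟨f i, (hf₁ i).2.trans_le (haN i)⟩,
    fun i => ha i _ (hf₁ i).1 (hf₁ i).2, fun i j h => ?_⟩
  rcases lt_trichotomy i j with hij | rfl | hij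
  · exact (hfar i j hij).not_gt h.2
  · exact h.1 rfl
  · exact (hfar j i hij).not_gt h.symm.2

/-! ### Lower bounds for the tree-independence parameters -/

/-- If a graph contains `weightedRows m N` as an induced subgraph, then each of its tree
decompositions has a bag with an independent set of `m` vertices of that subgraph. -/
theorem exists_bag_indepSet {V : Type*} {G : SimpleGraph V} (hN : 16 * 64 ^ m ≤ N)
    (φ : weightedRows m N ↪g G) {ι : Type} [Finite ι] (D : G.TreeDecomposition ι) :
    ∃ (t : ι) (s : Finset V), s.card = m ∧ ↑s ⊆ D.bag t ∧ G.IsIndepSet s := by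
  obtain ⟨t, f, hf, hfi⟩ := exists_bag_indep_transversal hN (D.comap φ)
  refine ⟨t, Finset.univ.map ⟨fun i => φ (i, f i), fun i j h => ?_⟩, by simp, ?_, ?_⟩
  · exact congrArg Prod.fst (φ.injective h)
  · intro v hv
    obtain ⟨i, -, rfl⟩ := Finset.mem_map.1 (Finset.mem_coe.1 hv)
    exact hf i
  · intro u hu v hv _
    obtain ⟨i, -, rfl⟩ := Finset.mem_map.1 (Finset.mem_coe.1 hu)
    obtain ⟨j, -, rfl⟩ := Finset.mem_map.1 (Finset.mem_coe.1 hv)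
    exact φ.map_adj_iff.not.2 (hfi i j)

theorem le_treeAlpha_of_embedding {V : Type*} [Finite V] {G : SimpleGraph V}
    (hN : 16 * 64 ^ m ≤ N) (φ : weightedRows m N ↪g G) : m ≤ G.treeAlpha := by
  refine le_treeAlpha fun ι _ D => ?_
  obtain ⟨t, s, hs, hsD, hsi⟩ := exists_bag_indepSet hN φ D
  exact ⟨t, hs ▸ card_le_indepNum_induce hsD hsi⟩

/-- With a universal vertex, at most three layers are nonempty. -/
theorem lt_layeredTreeAlpha {V : Type*} [Finite V] {G : SimpleGraph V} {k : ℕ}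
    (hN : 16 * 64 ^ (3 * k + 1) ≤ N) (φ : weightedRows (3 * k + 1) N ↪g G) {c : V}
    (hc : ∀ v, v ≠ c → G.Adj c v) : k < G.layeredTreeAlpha := by
  by_contra! hk
  obtain ⟨ι, _, D, L, hL, hD⟩ := exists_layering_of_layeredTreeAlpha_le hk
  obtain ⟨t, s, hs, hsD, hsi⟩ := exists_bag_indepSet hN φ D
  -- Pigeonhole: `3 * k + 1` vertices in at most three layers. Truncation of `L c - 1` at `L c = 0`
  -- only shrinks the interval.
  obtain ⟨i, -, hi⟩ := Finset.exists_lt_card_fiber_of_mul_lt_card_of_maps_to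
    (s := s) (t := Finset.Icc (L c - 1) (L c + 1)) (f := L) (n := k) (fun v _ => by
      rw [Finset.mem_Icc]
      by_cases hvc : v = c
      · subst hvc; omega
      · have := hL c v (hc v hvc)
        omega) (by
      have : (Finset.Icc (L c - 1) (L c + 1)).card ≤ 3 := by rw [Nat.card_Icc]; omega
      nlinarith)
  refine (hi.trans_le ?_).not_ge (hD t i)
  refine card_le_indepNum_induce (fun v hv => ?_) (hsi.mono ?_)
  · have := Finset.mem_filter.1 (Finset.mem_coe.1 hv)
    exact ⟨hsD this.1, this.2⟩
  · exact Finset.coe_subset.2 (Finset.filter_subset _ _)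

theorem exists_isHUDG_universal_vertex (m : ℕ) :
    ∃ (V : Type) (_ : Finite V) (G : SimpleGraph V) (c : V) (N : ℕ) (_ : weightedRows m N ↪g G),
      G.IsHUDG ∧ 16 * 64 ^ m ≤ N ∧ ∀ v, v ≠ c → G.Adj c v := by
  obtain ⟨G, hG, hc, hadj⟩ := exists_isHUDG_extending_weightedRows m (16 * 64 ^ m)
  refine ⟨_, inferInstance, G, none, _,
    ⟨⟨some, Option.some_injective _⟩, fun {a b} => hadj a b⟩, hG, le_rfl, fun v hv => ?_⟩
  obtain ⟨a, rfl⟩ := Option.ne_none_iff_exists'.1 hv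
  exact hc a

theorem lt_localTreeAlpha_one {V : Type*} [Finite V] {G : SimpleGraph V} {k : ℕ}
    (hN : 16 * 64 ^ (k + 1) ≤ N) (φ : weightedRows (k + 1) N ↪g G) {c : V}
    (hc : ∀ v, v ≠ c → G.Adj c v) : k < G.localTreeAlpha 1 := by
  have hmem (v : V) : v ∈ G.closedNeighborhood 1 c := by
    change G.edist c v ≤ ((1 : ℕ) : ℕ∞)
    rw [Nat.cast_one, edist_le_one_iff_adj_or_eq]
    by_cases h : v = c
    · exact Or.inr h.symm
    · exact Or.inl (hc v h)
  have h : k + 1 ≤ (G.induce (G.closedNeighborhood 1 c)).treeAlpha :=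
    le_treeAlpha_of_embedding hN
      ⟨⟨fun a => ⟨φ a, hmem _⟩, fun a b h => φ.injective (congrArg Subtype.val h)⟩,
        φ.map_adj_iff⟩
  exact Nat.lt_of_succ_le (h.trans (le_ciSup
    (f := fun v => (G.induce (G.closedNeighborhood 1 v)).treeAlpha) (Set.finite_range _).bddAbove c))

end SimpleGraph

theorem corollary5 :
    ¬ HasBoundedLocalTreeAlpha (fun _ G => G.IsHUDG) ∧
    (∀ k : ℕ, ∃ (V : Type) (_ : Finite V) (G : SimpleGraph V),
      G.IsHUDG ∧ k < G.localTreeAlpha 1) ∧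
    ¬ HasBoundedLayeredTreeAlpha (fun _ G => G.IsHUDG) := by
  have hlocal (k : ℕ) : ∃ (V : Type) (_ : Finite V) (G : SimpleGraph V),
      G.IsHUDG ∧ k < G.localTreeAlpha 1 := by
    obtain ⟨V, hV, G, c, N, φ, hG, hN, hc⟩ := SimpleGraph.exists_isHUDG_universal_vertex (k + 1)
    exact ⟨V, hV, G, hG, SimpleGraph.lt_localTreeAlpha_one hN φ hc⟩
  refine ⟨?_, hlocal, ?_⟩
  · rintro ⟨f, hf⟩
    obtain ⟨V, hV, G, hG, h⟩ := hlocal (f 1)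
    exact (hf V G hG 1).not_gt h
  · rintro ⟨k, hk⟩
    obtain ⟨V, hV, G, c, N, φ, hG, hN, hc⟩ :=
      SimpleGraph.exists_isHUDG_universal_vertex (3 * k + 1)
    exact (hk V G hG).not_gt (SimpleGraph.lt_layeredTreeAlpha hN φ hc)
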